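/- For a unital $C^*$-algebra $\mathcal A$ let $T(\mathcal A)$ be the space of bounded linear functionals $\varphi$ on $\mathcal A$ with $\varphi(ab)=\varphi(ba)$, let $T(\mathcal A)^+_1$ be the set of positive $\varphi\in T(\mathcal A)$ of norm one, and let $\partial_eT(\mathcal A)^+_1$ be the set of its extreme points. A self-similar pair $(p,\Phi)$ consists of a projection $p\in M_k(\mathcal A)$ (for some $k$) such that the linear span of $\{a^*pb : a,b\in\mathcal A^k\}$ is dense in $\mathcal A$, and a $*$-isomorphism $\Phi$ of $\mathcal A$ onto $pM_k(\mathcal A)p$; it defines a bounded linear map $T_{(p,\Phi)}$ on $T(\mathcal A)$ by $T_{(p,\Phi)}(\varphi)=(\mathrm{Tr}_k\otimes\varphi)\circ\Phi$, where $\mathrm{Tr}_k$ is the unnormalized trace on $M_k(\mathbb C)$. If $T(\mathcal A)$ is finite dimensional, then $\partial_eT(\mathcal A)^+_1=\{\varphi_1,\dots,\varphi_n\}$ is a basis of $T(\mathcal A)$, and for a given enumeration of it the fundamental group $F(\mathcal A)\subset M_n(\mathbb C)$ is the set of the matrices $(m_{ij})$ of all the maps $T=T_{(p,\Phi)}$ in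 this basis, $T(\varphi_j)=\sum_i m_{ij}\varphi_i$. Put $F_{\det}(\mathcal A)=\{|\det M| : M\in F(\mathcal A)\}$. For $\sigma\in S_n$ let $U(\sigma)_{ij}=1$ if $j=\sigma(i)$ and $U(\sigma)_{ij}=0$ otherwise. **Proposition.** Let $\mathcal A$ and $\mathcal B$ be unital $C^*$-algebras whose spaces $T(\mathcal A)$, $T(\mathcal B)$ of bounded traces are finite dimensional, and suppose that $\mathcal A$ and $\mathcal B$ are Morita equivalent, i.e. that there is an $\mathcal A$-$\mathcal B$ imprimitivity bimodule. Then $\dim T(\mathcal A)=\dim T(\mathcal B)$, the sets $\partial_eT(\mathcal A)^+_1$ and $\partial_eT(\mathcal B)^+_1$ have the same cardinality $n$, and for all enumerations of these two sets, $F(\mathcal A)$ is weightedly isomorphic to $F(\mathcal B)$: there are a diagonal matrix $D\in M_n(\mathbb C)$ with positive diagonal entries and a permutation $\sigma\in S_n$ such that $$F(\mathcal B)=(DU(\sigma))^{-1}F(\mathcal A)(DU(\sigma)).$$ Moreover $F_{\det}(\mathcal A)=F_{\det}(\mathcal B)$. -/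

import Mathlib

open scoped ComplexOrder

/-- The space `T(A)` of bounded traces on `A`: bounded linear functionals `φ` with
`φ (a * b) = φ (b * a)`, as a subspace of the dual of `A`. -/
def boundedTraces (A : Type*) [CStarAlgebra A] : Submodule ℂ (A →L[ℂ] ℂ) where
  carrier := {φ | ∀ a b : A, φ (a * b) = φ (b * a)}
  add_mem' := by
    intro φ ψ hφ hψ a b
    simp [hφ a b, hψ a b]
  zero_mem' := by
    intro a b
    simp
  smul_mem' := by
    intro c φ hφ a b
    simp [hφ a b]

/-- The set `T(A)₁⁺` of positive bounded traces of norm one. -/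
def tracialStates (A : Type*) [CStarAlgebra A] : Set (boundedTraces A) :=
  {φ | (∀ a : A, 0 ≤ (φ : A →L[ℂ] ℂ) (star a * a)) ∧ ‖(φ : A →L[ℂ] ℂ)‖ = 1}

/-- The set `∂ₑT(A)₁⁺` of extreme points of `T(A)₁⁺`. -/
def extremalTraces (A : Type*) [CStarAlgebra A] : Set (boundedTraces A) :=
  (tracialStates A).extremePoints ℝ

/-- A self-similar pair `(p, Φ)` of size `k`: a projection `p ∈ M_k(A)` which is full, in the sense
that the elements `a⋆ p b` (`a, b ∈ A^k`) span a dense subspace of `A`, and a `⋆`-isomorphism `Φ`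
of `A` onto the corner `p M_k(A) p`. -/
structure SelfSimilarPair (A : Type*) [CStarAlgebra A] (k : ℕ) where
  p : CStarMatrix (Fin k) (Fin k) A
  isStarProjection : IsStarProjection p
  full : (Submodule.span ℂ
    {x : A | ∃ a b : Fin k → A, x = ∑ i, ∑ j, star (a i) * p i j * b j}).topologicalClosure = ⊤
  Φ : A →⋆ₙₐ[ℂ] CStarMatrix (Fin k) (Fin k) A
  injective : Function.Injective Φ
  range_eq : Set.range Φ = {x | ∃ y, x = p * y * p}

/-- `(Tr_k ⊗ φ) ∘ Φ` is a bounded functional. -/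
theorem exists_bound_trace_comp {A : Type*} [CStarAlgebra A] {k : ℕ}
    (Φ : A →⋆ₙₐ[ℂ] CStarMatrix (Fin k) (Fin k) A) (φ : A →L[ℂ] ℂ) (a : A) :
    ‖∑ i, φ (Φ a i i)‖ ≤ k * ‖φ‖ * ‖a‖ := by
  let _ : PartialOrder A := CStarAlgebra.spectralOrder A
  have _ : StarOrderedRing A := CStarAlgebra.spectralOrderedRing A
  have h1 : ∀ i ∈ (Finset.univ : Finset (Fin k)), ‖φ (Φ a i i)‖ ≤ ‖φ‖ * ‖a‖ := by
    intro i _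
    refine (φ.le_opNorm _).trans (mul_le_mul_of_nonneg_left ?_ (norm_nonneg φ))
    exact CStarMatrix.norm_entry_le_norm.trans (NonUnitalStarAlgHom.norm_apply_le Φ a)
  refine (norm_sum_le_of_le _ h1).trans ?_
  simp [mul_assoc]

/-- The functional `(Tr_k ⊗ φ) ∘ Φ`, where `Tr_k` is the unnormalized trace on `M_k(ℂ)`. -/
noncomputable def traceComp {A : Type*} [CStarAlgebra A] {k : ℕ}
    (Φ : A →⋆ₙₐ[ℂ] CStarMatrix (Fin k) (Fin k) A) (φ : A →L[ℂ] ℂ) : A →L[ℂ] ℂ :=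
  LinearMap.mkContinuous
    { toFun := fun a => ∑ i, φ (Φ a i i)
      map_add' := by
        intro a b
        simp [Finset.sum_add_distrib]
      map_smul' := by
        intro c a
        simp [Finset.mul_sum] }
    (k * ‖φ‖) (exists_bound_trace_comp Φ φ)

@[simp] theorem traceComp_apply {A : Type*} [CStarAlgebra A] {k : ℕ}
    (Φ : A →⋆ₙₐ[ℂ] CStarMatrix (Fin k) (Fin k) A) (φ : A →L[ℂ] ℂ) (a : A) :
    traceComp Φ φ a = ∑ i, φ (Φ a i i) := rfl

theorem traceComp_mem {A : Type*} [CStarAlgebra A] {k : ℕ}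
    (Φ : A →⋆ₙₐ[ℂ] CStarMatrix (Fin k) (Fin k) A) {φ : A →L[ℂ] ℂ} (hφ : φ ∈ boundedTraces A) :
    traceComp Φ φ ∈ boundedTraces A := by
  intro a b
  simp only [traceComp_apply, map_mul, CStarMatrix.mul_apply, map_sum]
  rw [Finset.sum_comm]
  refine Finset.sum_congr rfl fun i _ => Finset.sum_congr rfl fun j _ => hφ _ _

/-- The linear map `T_{(p, Φ)}` on `T(A)`, `φ ↦ (Tr_k ⊗ φ) ∘ Φ`. -/
noncomputable def SelfSimilarPair.traceLinearMap {A : Type*} [CStarAlgebra A] {k : ℕ}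
    (s : SelfSimilarPair A k) : boundedTraces A →ₗ[ℂ] boundedTraces A where
  toFun φ := ⟨traceComp s.Φ φ, traceComp_mem s.Φ φ.2⟩
  map_add' := by
    intro φ ψ
    ext a
    simp [Finset.sum_add_distrib]
  map_smul' := by
    intro c φ
    ext a
    simp [Finset.mul_sum]

/-- The bounded linear map `T_{(p, Φ)}` on `T(A)`, `φ ↦ (Tr_k ⊗ φ) ∘ Φ`. -/
noncomputable def SelfSimilarPair.traceMap {A : Type*} [CStarAlgebra A] {k : ℕ}
    (s : SelfSimilarPair A k) : boundedTraces A →L[ℂ] boundedTraces A :=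
  ⟨s.traceLinearMap, AddMonoidHomClass.continuous_of_bound s.traceLinearMap k fun φ =>
    LinearMap.mkContinuous_norm_le _ (mul_nonneg k.cast_nonneg (norm_nonneg _))
      (exists_bound_trace_comp s.Φ φ)⟩

/-- `F^{tr}(A)`: the set of all the maps `T_{(p, Φ)}` on `T(A)`. -/
def traceFundamentalGroup (A : Type*) [CStarAlgebra A] :
    Set (boundedTraces A →L[ℂ] boundedTraces A) :=
  {T | ∃ (k : ℕ) (s : SelfSimilarPair A k), T = s.traceMap}

/-- The fundamental group `F(A)` with respect to an enumeration `e` of the extremal traces: the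
representation matrices, with respect to `e`, of the elements of `F^{tr}(A)`
(column `j` contains the coefficients of the image of `e j`). -/
def fundamentalGroup {A : Type*} [CStarAlgebra A] {n : ℕ} (e : Fin n ≃ extremalTraces A) :
    Set (Matrix (Fin n) (Fin n) ℂ) :=
  {M | ∃ T ∈ traceFundamentalGroup A,
    ∀ j, T (e j : boundedTraces A) = ∑ i, M i j • (e i : boundedTraces A)}

/-- The determinant fundamental group `F_det(A) = |det| (F(A))`. -/
def detFundamentalGroup {A : Type*} [CStarAlgebra A] {n : ℕ} (e : Fin n ≃ extremalTraces A) :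
    Set ℝ :=
  (fun M => ‖M.det‖) '' fundamentalGroup e

/-- `F₂ = (D U(σ))⁻¹ F₁ (D U(σ))` for some positive invertible diagonal matrix `D` and some
permutation `σ`. Here `U(σ) i j = 1` if `j = σ i`, and `0` otherwise. -/
def WeightedlyIsomorphic {n : ℕ} (F₁ F₂ : Set (Matrix (Fin n) (Fin n) ℂ)) : Prop :=
  ∃ (d : Fin n → ℝ) (σ : Equiv.Perm (Fin n)), (∀ i, 0 < d i) ∧
    F₂ = (fun M => (Matrix.diagonal (fun i => (d i : ℂ)) * σ.permMatrix ℂ)⁻¹ * M *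
      (Matrix.diagonal (fun i => (d i : ℂ)) * σ.permMatrix ℂ)) '' F₁

/-- An `A`-`B` imprimitivity bimodule structure on a Banach space `E` which is a left `A`-module and
a right `B`-module: commuting actions, a left `A`-valued and a right `B`-valued inner product which
make `E` a full left Hilbert `A`-module and a full right Hilbert `B`-module, with each algebra acting
by adjointable operators for the other inner product, and linked by `⟪x, y⟫_A z = x ⟪y, z⟫_B`.
The norm of `E` is the one given by either inner product. -/
structure ImprimitivityBimodule (A B E : Type*) [CStarAlgebra A] [CStarAlgebra B]
    [NormedAddCommGroup E] [NormedSpace ℂ E] [CompleteSpace E]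
    [Module A E] [Module Bᵐᵒᵖ E] where
  complex_smul_left (c : ℂ) (a : A) (x : E) : (c • a) • x = c • (a • x)
  complex_smul_right (c : ℂ) (b : B) (x : E) : MulOpposite.op (c • b) • x = c • (MulOpposite.op b • x)
  smul_comm (a : A) (b : B) (x : E) : a • (MulOpposite.op b • x) = MulOpposite.op b • (a • x)
  /-- the left inner product `⟪x, y⟫_A`, linear in `x` -/
  leftInner : E → E → A
  leftInner_add (x y z : E) : leftInner (x + y) z = leftInner x z + leftInner y z
  leftInner_smul (a : A) (x y : E) : leftInner (a • x) y = a * leftInner x y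
  star_leftInner (x y : E) : star (leftInner x y) = leftInner y x
  leftInner_self_pos (x : E) : ∃ c : A, leftInner x x = star c * c
  norm_leftInner_self (x : E) : ‖leftInner x x‖ = ‖x‖ ^ 2
  left_full : (Submodule.span ℂ {a : A | ∃ x y, a = leftInner x y}).topologicalClosure = ⊤
  /-- the right inner product `⟪x, y⟫_B`, linear in `y` -/
  rightInner : E → E → B
  rightInner_add (x y z : E) : rightInner x (y + z) = rightInner x y + rightInner x z
  rightInner_smul (b : B) (x y : E) : rightInner x (MulOpposite.op b • y) = rightInner x y * b
  star_rightInner (x y : E) : star (rightInner x y) = rightInner y x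
  rightInner_self_pos (x : E) : ∃ c : B, rightInner x x = star c * c
  norm_rightInner_self (x : E) : ‖rightInner x x‖ = ‖x‖ ^ 2
  right_full : (Submodule.span ℂ {b : B | ∃ x y, b = rightInner x y}).topologicalClosure = ⊤
  leftInner_adjoint (b : B) (x y : E) : leftInner (MulOpposite.op b • x) y = leftInner x (MulOpposite.op (star b) • y)
  rightInner_adjoint (a : A) (x y : E) : rightInner (a • x) y = rightInner x (star a • y)
  leftInner_smul_eq (x y z : E) : leftInner x y • z = MulOpposite.op (rightInner y z) • x

universe u v w

/-- `A` and `B` are Morita equivalent: there is an `A`-`B` imprimitivity bimodule (in the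
universe `w`). -/
def MoritaEquivalent (A : Type u) (B : Type v) [CStarAlgebra A] [CStarAlgebra B] : Prop :=
  ∃ (E : Type w) (_ : NormedAddCommGroup E) (_ : NormedSpace ℂ E) (_ : CompleteSpace E)
    (_ : Module A E) (_ : Module Bᵐᵒᵖ E), Nonempty (ImprimitivityBimodule A B E)

/-! Over unital algebras an imprimitivity bimodule `E` has finite frames: `ξ` with `∑ ⟪ξ i, ξ i⟫_A =
1` and `η` with `∑ ⟪η j, η j⟫_B = 1`. The map `a ↦ (⟪ξ i, a ξ j⟫_B)` identifies `A` with a full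
corner of a matrix algebra over `B`, and `η` does the same with the roles exchanged
(`isFullCorner_frameHom`).

Pulling traces back along these corners gives maps `T(B) → T(A)` and `T(A) → T(B)`. The first
satisfies `(Sφ)(⟪x, y⟫_A) = φ(⟪y, x⟫_B)`, whatever the frame, and the two are mutually inverse. Both
preserve positivity. Full corners compose, so sandwiching a self-similar pair of `A` between the two
corners gives one of `B`, with trace map `S⁻¹ T S`.

The tracial states form a base of the cone of positive traces, and a cone isomorphism permutes
extreme rays. Hence `S` sends each extremal trace to a positive multiple of an extremal trace. Its
matrix is a positive diagonal matrix times a permutation matrix, and conjugation by it carries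
`F(A)` to `F(B)` without changing determinants. -/

/-! ### Full corners of matrix algebras and their composition -/

section CornerHom

variable {A B C : Type*} [CStarAlgebra A] [CStarAlgebra B] [CStarAlgebra C]
  {ι κ : Type*} [Fintype ι] [Fintype κ]

/-- The matrix with given entries. -/
def CStarMatrix.ofEntries {m n R : Type*} (f : m → n → R) : CStarMatrix m n R := f

@[simp] theorem CStarMatrix.ofEntries_apply {m n R : Type*} (f : m → n → R) (i : m) (j : n) :
    CStarMatrix.ofEntries f i j = f i j := rfl

theorem CStarMatrix.sum_entry {m n R σ : Type*} [AddCommMonoid R] (s : Finset σ)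
    (f : σ → CStarMatrix m n R) (i : m) (j : n) : (∑ x ∈ s, f x) i j = ∑ x ∈ s, f x i j :=
  Matrix.sum_apply i j s f

/-- A `⋆`-isomorphism of `A` onto a full corner of `M_ι(B)`, where fullness means that no proper
two-sided ideal of `B` contains the entries of the corner projection `Θ 1`. -/
structure IsFullCorner (Θ : A →⋆ₙₐ[ℂ] CStarMatrix ι ι B) : Prop where
  injective : Function.Injective Θ
  exists_eq (y : CStarMatrix ι ι B) : ∃ a, Θ a = Θ 1 * y * Θ 1
  one_mem (J : TwoSidedIdeal B) (hJ : ∀ i j, Θ 1 i j ∈ J) : (1 : B) ∈ J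

/-- The homomorphism `A → M_ι(B) → M_{ι × κ}(C)` obtained by applying `Ψ` entrywise. -/
noncomputable def matrixComp (Ψ : B →⋆ₙₐ[ℂ] CStarMatrix κ κ C) (Θ : A →⋆ₙₐ[ℂ] CStarMatrix ι ι B) :
    A →⋆ₙₐ[ℂ] CStarMatrix (ι × κ) (ι × κ) C where
  toFun a := CStarMatrix.ofEntries fun p q => Ψ (Θ a p.1 q.1) p.2 q.2
  map_smul' c a := by
    ext p q
    simp
  map_zero' := by
    ext p q
    simp
  map_add' a b := by
    ext p q
    simp
  map_mul' a b := by
    ext p q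
    simp only [map_mul, CStarMatrix.mul_apply, map_sum, CStarMatrix.ofEntries_apply,
      Fintype.sum_prod_type, CStarMatrix.sum_entry]
  map_star' a := by
    ext p q
    simp [map_star, CStarMatrix.star_apply]

@[simp] theorem matrixComp_apply (Ψ : B →⋆ₙₐ[ℂ] CStarMatrix κ κ C)
    (Θ : A →⋆ₙₐ[ℂ] CStarMatrix ι ι B) (a : A) (p q : ι × κ) :
    matrixComp Ψ Θ a p q = Ψ (Θ a p.1 q.1) p.2 q.2 := rfl

/-- Reindexing a homomorphism into a matrix algebra. -/
noncomputable def matrixReindex (e : κ ≃ ι) (Θ : A →⋆ₙₐ[ℂ] CStarMatrix ι ι B) :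
    A →⋆ₙₐ[ℂ] CStarMatrix κ κ B where
  toFun a := CStarMatrix.ofEntries fun p q => Θ a (e p) (e q)
  map_smul' c a := by
    ext p q
    simp
  map_zero' := by
    ext p q
    simp
  map_add' a b := by
    ext p q
    simp
  map_mul' a b := by
    ext p q
    simp only [map_mul, CStarMatrix.mul_apply, CStarMatrix.ofEntries_apply]
    exact (e.sum_comp fun i => Θ a (e p) i * Θ b i (e q)).symm
  map_star' a := by
    ext p q
    simp [map_star, CStarMatrix.star_apply]

@[simp] theorem matrixReindex_apply (e : κ ≃ ι) (Θ : A →⋆ₙₐ[ℂ] CStarMatrix ι ι B) (a : A)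
    (p q : κ) : matrixReindex e Θ a p q = Θ a (e p) (e q) := rfl

theorem IsFullCorner.matrixReindex {Θ : A →⋆ₙₐ[ℂ] CStarMatrix ι ι B} (hΘ : IsFullCorner Θ)
    (e : κ ≃ ι) : IsFullCorner (matrixReindex e Θ) where
  injective a b hab := hΘ.injective <| CStarMatrix.ext fun i j => by
    simpa using congrArg (fun M : CStarMatrix κ κ B => M (e.symm i) (e.symm j)) hab
  exists_eq y := by
    obtain ⟨a, ha⟩ := hΘ.exists_eq (CStarMatrix.ofEntries fun i j => y (e.symm i) (e.symm j))
    refine ⟨a, CStarMatrix.ext fun p q => ?_⟩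
    rw [matrixReindex_apply, ha]
    simp only [CStarMatrix.mul_apply, CStarMatrix.ofEntries_apply, matrixReindex_apply]
    rw [← e.sum_comp]
    refine Finset.sum_congr rfl fun j _ => ?_
    rw [← e.sum_comp]
    simp
  one_mem J hJ := hΘ.one_mem J fun i j => by simpa using hJ (e.symm i) (e.symm j)

/-- The elements of `A` which `Θ` maps to matrices with entries in a given ideal. -/
def matrixComapIdeal (Θ : A →⋆ₙₐ[ℂ] CStarMatrix ι ι B) (J : TwoSidedIdeal B) :
    TwoSidedIdeal A :=
  .mk' {a | ∀ i j, Θ a i j ∈ J}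
    (by intro i j; simp [J.zero_mem])
    (by
      intro a b ha hb i j
      simpa using J.add_mem (ha i j) (hb i j))
    (by
      intro a ha i j
      simpa using J.neg_mem (ha i j))
    (by
      intro a b hb i j
      rw [map_mul, CStarMatrix.mul_apply]
      exact sum_mem fun w _ => J.mul_mem_left _ _ (hb w j))
    (by
      intro a b ha i j
      rw [map_mul, CStarMatrix.mul_apply]
      exact sum_mem fun w _ => J.mul_mem_right _ _ (ha i w))

theorem mem_matrixComapIdeal {Θ : A →⋆ₙₐ[ℂ] CStarMatrix ι ι B} {J : TwoSidedIdeal B} {a : A} :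
    a ∈ matrixComapIdeal Θ J ↔ ∀ i j, Θ a i j ∈ J := by
  rw [matrixComapIdeal, TwoSidedIdeal.mem_mk']
  rfl

/-- A corner of a corner is a corner: each block of `y` is compressed by `Ψ 1` and lifted to `B`,
then the lifted matrix is compressed by `Θ 1`. For fullness, the entries of `Θ 1` lie in the ideal
of elements that `Ψ` sends into `J`, so that ideal contains `1`. -/
theorem IsFullCorner.matrixComp {Ψ : B →⋆ₙₐ[ℂ] CStarMatrix κ κ C}
    {Θ : A →⋆ₙₐ[ℂ] CStarMatrix ι ι B} (hΨ : IsFullCorner Ψ) (hΘ : IsFullCorner Θ) :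
    IsFullCorner (matrixComp Ψ Θ) where
  injective a b hab := hΘ.injective <| CStarMatrix.ext fun i j =>
    hΨ.injective <| CStarMatrix.ext fun s t =>
      congrArg (fun M : CStarMatrix (ι × κ) (ι × κ) C => M (i, s) (j, t)) hab
  exists_eq y := by
    have h : ∀ i j, ∃ b, Ψ b = Ψ 1 * (CStarMatrix.ofEntries fun s t => y (i, s) (j, t)) * Ψ 1 :=
      fun i j => hΨ.exists_eq _
    choose b hb using h
    obtain ⟨a, ha⟩ := hΘ.exists_eq (CStarMatrix.ofEntries b)
    refine ⟨a, CStarMatrix.ext fun p q => ?_⟩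
    obtain ⟨i, s⟩ := p
    obtain ⟨j, t⟩ := q
    -- The factors `Ψ 1` coming from the lift are absorbed by the neighbouring values of `Ψ`.
    have h1 : ∀ m n, Ψ (Θ 1 i m * b m n * Θ 1 n j) =
        Ψ (Θ 1 i m) * (CStarMatrix.ofEntries fun s t => y (m, s) (n, t)) * Ψ (Θ 1 n j) := by
      intro m n
      rw [map_mul, map_mul, hb, mul_assoc, mul_assoc, ← map_mul Ψ 1, one_mul, ← mul_assoc,
        ← mul_assoc, ← map_mul, mul_one]
    have h2 : Ψ (Θ a i j) = ∑ n, ∑ m,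
        Ψ (Θ 1 i m) * (CStarMatrix.ofEntries fun s t => y (m, s) (n, t)) * Ψ (Θ 1 n j) := by
      simp only [ha, CStarMatrix.mul_apply, map_sum, Finset.sum_mul, CStarMatrix.ofEntries_apply, h1]
    rw [matrixComp_apply, h2]
    simp only [CStarMatrix.sum_entry, CStarMatrix.mul_apply, CStarMatrix.ofEntries_apply, matrixComp_apply,
      Fintype.sum_prod_type, Finset.sum_mul]
    refine Finset.sum_congr rfl fun n _ => ?_
    rw [Finset.sum_comm]
  one_mem J hJ := by
    refine hΨ.one_mem J (mem_matrixComapIdeal.1 (hΘ.one_mem (matrixComapIdeal Ψ J) fun i j => ?_))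
    exact mem_matrixComapIdeal.2 fun s t => hJ (i, s) (j, t)

/-- Each of `Φ 1` and `p` absorbs the other: `p` lies in the range of `Φ`, where `Φ 1` is a unit,
and `Φ 1` lies in `p M_k(A) p`. -/
theorem SelfSimilarPair.Φ_one {k : ℕ} (s : SelfSimilarPair A k) : s.Φ 1 = s.p := by
  have hp := s.isStarProjection.isIdempotentElem.eq
  obtain ⟨y, hy⟩ : ∃ y, s.Φ 1 = s.p * y * s.p := by
    have : s.Φ 1 ∈ Set.range s.Φ := ⟨1, rfl⟩
    rwa [s.range_eq] at this
  obtain ⟨a, ha⟩ : s.p ∈ Set.range s.Φ := by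
    rw [s.range_eq]
    exact ⟨s.p, by rw [hp, hp]⟩
  calc s.Φ 1 = s.Φ 1 * s.p := by rw [hy, mul_assoc (s.p * y), hp]
    _ = s.p := by rw [← ha, ← map_mul, one_mul]

/-- Density can be replaced by an algebraic condition because the units form an open set: a dense
span contains a unit, so an ideal containing the span contains `1`. -/
theorem SelfSimilarPair.isFullCorner {k : ℕ} (s : SelfSimilarPair A k) : IsFullCorner s.Φ where
  injective := s.injective
  exists_eq y := by
    rw [s.Φ_one]
    have : s.p * y * s.p ∈ Set.range s.Φ := by
      rw [s.range_eq]
      exact ⟨y, rfl⟩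
    exact this
  one_mem J hJ := by
    rw [s.Φ_one] at hJ
    have hle : (Submodule.span ℂ {x : A | ∃ a b : Fin k → A,
        x = ∑ i, ∑ j, star (a i) * s.p i j * b j} : Set A) ⊆ J := by
      intro x hx
      induction hx using Submodule.span_induction with
      | mem x hx =>
        obtain ⟨a, b, rfl⟩ := hx
        exact sum_mem fun i _ => sum_mem fun j _ =>
          J.mul_mem_right _ _ (J.mul_mem_left _ _ (hJ i j))
      | zero => exact J.zero_mem
      | add x y _ _ hx hy => exact J.add_mem hx hy
      | smul c x _ hx =>
        rw [← one_mul x, ← smul_mul_assoc]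
        exact J.mul_mem_left _ _ hx
    have h1 : (1 : A) ∈ closure (Submodule.span ℂ {x : A | ∃ a b : Fin k → A,
        x = ∑ i, ∑ j, star (a i) * s.p i j * b j} : Set A) := by
      rw [← Submodule.topologicalClosure_coe, s.full]
      trivial
    obtain ⟨x, hxu, hx⟩ := mem_closure_iff.1 h1 _ Units.isOpen isUnit_one
    obtain ⟨u, rfl⟩ := hxu
    simpa using J.mul_mem_left (↑u⁻¹ : A) _ (hle hx)

/-- The span in the definition of fullness is itself a two-sided ideal containing the entries of `Φ
1`, so it is all of `A` even before taking the closure. -/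
theorem IsFullCorner.exists_selfSimilarPair {k : ℕ} {Φ : A →⋆ₙₐ[ℂ] CStarMatrix (Fin k) (Fin k) A}
    (hΦ : IsFullCorner Φ) : ∃ s : SelfSimilarPair A k, s.Φ = Φ := by
  refine ⟨⟨Φ 1, ?_, ?_, Φ, hΦ.injective, ?_⟩, rfl⟩
  · exact ⟨by rw [IsIdempotentElem, ← map_mul, one_mul],
      by rw [IsSelfAdjoint, ← map_star, star_one]⟩
  · set V : Submodule ℂ A := Submodule.span ℂ
      {x : A | ∃ a b : Fin k → A, x = ∑ i, ∑ j, star (a i) * Φ 1 i j * b j} with hV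
    have hl : ∀ x y : A, y ∈ V → x * y ∈ V := by
      intro x y hy
      induction hy using Submodule.span_induction with
      | mem y hy =>
        obtain ⟨a, b, rfl⟩ := hy
        refine Submodule.subset_span ⟨fun i => a i * star x, b, ?_⟩
        simp [Finset.mul_sum, mul_assoc]
      | zero => simp
      | add y z _ _ hy hz => rw [mul_add]; exact V.add_mem hy hz
      | smul c y _ hy => rw [mul_smul_comm]; exact V.smul_mem c hy
    have hr : ∀ x y : A, x ∈ V → x * y ∈ V := by
      intro x y hx
      induction hx using Submodule.span_induction with
      | mem x hx =>
        obtain ⟨a, b, rfl⟩ := hx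
        refine Submodule.subset_span ⟨a, fun i => b i * y, ?_⟩
        simp [Finset.sum_mul, mul_assoc]
      | zero => simp
      | add y z _ _ hy hz => rw [add_mul]; exact V.add_mem hy hz
      | smul c y _ hy => rw [smul_mul_assoc]; exact V.smul_mem c hy
    have h1 : (1 : A) ∈ V := by
      have := hΦ.one_mem (.mk' (V : Set A) V.zero_mem V.add_mem V.neg_mem (hl _ _) (hr _ _)) ?_
      · rwa [TwoSidedIdeal.mem_mk'] at this
      intro i j
      rw [TwoSidedIdeal.mem_mk']
      refine Submodule.subset_span ⟨Pi.single i 1, Pi.single j 1, ?_⟩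
      rw [Finset.sum_eq_single i, Finset.sum_eq_single j] <;> simp +contextual [Pi.single_apply]
    have h2 : V = ⊤ := by
      refine eq_top_iff.2 fun x _ => ?_
      simpa using hl x 1 h1
    rw [h2]
    exact top_le_iff.1 (Submodule.le_topologicalClosure _)
  · ext x
    constructor
    · rintro ⟨a, rfl⟩
      exact ⟨Φ a, by rw [← map_mul, ← map_mul, one_mul, mul_one]⟩
    · rintro ⟨y, rfl⟩
      exact hΦ.exists_eq y

/-! ### Pulling back traces along corners -/

theorem exists_bound_sum_diag (Θ : A →⋆ₙₐ[ℂ] CStarMatrix ι ι B) (φ : B →L[ℂ] ℂ) (a : A) :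
    ‖∑ i, φ (Θ a i i)‖ ≤ Fintype.card ι * ‖φ‖ * ‖a‖ := by
  let _ : PartialOrder A := CStarAlgebra.spectralOrder A
  have _ : StarOrderedRing A := CStarAlgebra.spectralOrderedRing A
  let _ : PartialOrder B := CStarAlgebra.spectralOrder B
  have _ : StarOrderedRing B := CStarAlgebra.spectralOrderedRing B
  have h1 : ∀ i ∈ (Finset.univ : Finset ι), ‖φ (Θ a i i)‖ ≤ ‖φ‖ * ‖a‖ := by
    intro i _
    refine (φ.le_opNorm _).trans (mul_le_mul_of_nonneg_left ?_ (norm_nonneg φ))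
    exact CStarMatrix.norm_entry_le_norm.trans (NonUnitalStarAlgHom.norm_apply_le Θ a)
  refine (norm_sum_le_of_le _ h1).trans ?_
  simp [mul_assoc]

/-- The linear map `φ ↦ (Tr ⊗ φ) ∘ Θ` from the bounded traces on `B` to those on `A`. -/
noncomputable def tracePullback (Θ : A →⋆ₙₐ[ℂ] CStarMatrix ι ι B) :
    boundedTraces B →ₗ[ℂ] boundedTraces A where
  toFun φ := ⟨LinearMap.mkContinuous
    { toFun := fun a => ∑ i, (φ : B →L[ℂ] ℂ) (Θ a i i)
      map_add' := by
        intro a b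
        simp [Finset.sum_add_distrib]
      map_smul' := by
        intro c a
        simp [Finset.mul_sum] } _ (exists_bound_sum_diag Θ φ), by
    intro a b
    simp only [LinearMap.mkContinuous_apply, LinearMap.coe_mk, AddHom.coe_mk, map_mul,
      CStarMatrix.mul_apply, map_sum]
    rw [Finset.sum_comm]
    exact Finset.sum_congr rfl fun i _ => Finset.sum_congr rfl fun j _ => φ.2 _ _⟩
  map_add' φ ψ := by
    ext a
    simp [Finset.sum_add_distrib]
  map_smul' c φ := by
    ext a
    simp [Finset.mul_sum]

@[simp] theorem tracePullback_apply (Θ : A →⋆ₙₐ[ℂ] CStarMatrix ι ι B) (φ : boundedTraces B)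
    (a : A) : (tracePullback Θ φ : A →L[ℂ] ℂ) a = ∑ i, (φ : B →L[ℂ] ℂ) (Θ a i i) := rfl

theorem tracePullback_matrixComp (Ψ : B →⋆ₙₐ[ℂ] CStarMatrix κ κ C)
    (Θ : A →⋆ₙₐ[ℂ] CStarMatrix ι ι B) (φ : boundedTraces C) :
    tracePullback (matrixComp Ψ Θ) φ = tracePullback Θ (tracePullback Ψ φ) := by
  ext a
  simp [Fintype.sum_prod_type]

theorem tracePullback_matrixReindex (e : κ ≃ ι) (Θ : A →⋆ₙₐ[ℂ] CStarMatrix ι ι B)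
    (φ : boundedTraces B) : tracePullback (matrixReindex e Θ) φ = tracePullback Θ φ := by
  ext a
  simp only [tracePullback_apply, matrixReindex_apply]
  exact e.sum_comp fun i => (φ : B →L[ℂ] ℂ) (Θ a i i)

theorem SelfSimilarPair.traceMap_apply {k : ℕ} (s : SelfSimilarPair A k) (φ : boundedTraces A) :
    s.traceMap φ = tracePullback s.Φ φ := rfl

theorem tracePullback_nonneg (Θ : A →⋆ₙₐ[ℂ] CStarMatrix ι ι B) {φ : boundedTraces B}
    (hφ : ∀ b : B, 0 ≤ (φ : B →L[ℂ] ℂ) (star b * b)) (a : A) :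
    0 ≤ (tracePullback Θ φ : A →L[ℂ] ℂ) (star a * a) := by
  simp only [tracePullback_apply, map_mul, map_star, CStarMatrix.mul_apply, map_sum,
    CStarMatrix.star_apply]
  exact Finset.sum_nonneg fun i _ => Finset.sum_nonneg fun j _ => hφ _

/-- A self-similar pair on `A` is transported by full corner homomorphisms `B → M_κ(A)` and
`A → M_ι(B)` to a self-similar pair on `B`. -/
theorem exists_mem_traceFundamentalGroup_conj {Θ : A →⋆ₙₐ[ℂ] CStarMatrix ι ι B}
    {Ψ : B →⋆ₙₐ[ℂ] CStarMatrix κ κ A} (hΘ : IsFullCorner Θ) (hΨ : IsFullCorner Ψ)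
    {T : boundedTraces A →L[ℂ] boundedTraces A} (hT : T ∈ traceFundamentalGroup A) :
    ∃ T' ∈ traceFundamentalGroup B, ∀ φ,
      T' φ = tracePullback Ψ (T (tracePullback Θ φ)) := by
  obtain ⟨k, s, rfl⟩ := hT
  -- The composite `B → M_κ(A) → M_{κ × k}(A) → M_{(κ × k) × ι}(B)`, reindexed by a `Fin`.
  have h := ((hΘ.matrixComp (s.isFullCorner.matrixComp hΨ)).matrixReindex
    (Fintype.equivFin ((κ × Fin k) × ι)).symm)
  obtain ⟨s', hs'⟩ := h.exists_selfSimilarPair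
  refine ⟨s'.traceMap, ⟨_, s', rfl⟩, fun φ => ?_⟩
  rw [s'.traceMap_apply, hs', tracePullback_matrixReindex, tracePullback_matrixComp,
    tracePullback_matrixComp, s.traceMap_apply]

end CornerHom

/-! ### Existence of finite frames -/

section Frame

/-- In a full inner product module over a unital C⋆-algebra the unit is a sum of elements
`⟪x, x⟫`. The action of the algebra is given as a function. -/
theorem exists_sum_inner_self_eq_one {B E : Type*} [CStarAlgebra B] [AddCommGroup E]
    (act : B → E → E) (inner : E → E → B)
    (inner_add : ∀ x y z, inner x (y + z) = inner x y + inner x z)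
    (inner_act : ∀ b x y, inner x (act b y) = inner x y * b)
    (star_inner : ∀ x y, star (inner x y) = inner y x)
    (pos : ∀ x, ∃ c : B, inner x x = star c * c)
    (full : (Submodule.span ℂ {b : B | ∃ x y, b = inner x y}).topologicalClosure = ⊤) :
    ∃ (n : ℕ) (ξ : Fin n → E), ∑ i, inner (ξ i) (ξ i) = 1 := by
  let _ : PartialOrder B := CStarAlgebra.spectralOrder B
  have _ : StarOrderedRing B := CStarAlgebra.spectralOrderedRing B
  have h1 : (1 : B) ∈ closure
      (Submodule.span ℂ {b : B | ∃ x y, b = inner x y} : Set B) := by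
    rw [← Submodule.topologicalClosure_coe, full]
    trivial
  obtain ⟨c, hcu, hc⟩ := mem_closure_iff.1 h1 _ Units.isOpen isUnit_one
  have hspan : ∃ (n : ℕ) (x y : Fin n → E), c = ∑ i, inner (x i) (y i) := by
    clear hcu
    induction hc using Submodule.span_induction with
    | mem c hc =>
      obtain ⟨x, y, rfl⟩ := hc
      exact ⟨1, fun _ => x, fun _ => y, by simp⟩
    | zero => exact ⟨0, Fin.elim0, Fin.elim0, by simp⟩
    | add a b _ _ ha hb =>
      obtain ⟨n, x, y, rfl⟩ := ha
      obtain ⟨m, x', y', rfl⟩ := hb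
      exact ⟨n + m, Fin.append x x', Fin.append y y', by simp [Fin.sum_univ_add]⟩
    | smul r a _ ha =>
      obtain ⟨n, x, y, rfl⟩ := ha
      refine ⟨n, x, fun i => act (r • 1) (y i), ?_⟩
      simp [inner_act, Finset.smul_sum]
  obtain ⟨n, x, y, hxy⟩ := hspan
  obtain ⟨u, rfl⟩ := hcu
  -- The unit `u` in the span is normalized to `1` by acting with `u⁻¹` on the second entries.
  obtain ⟨z, hz⟩ : ∃ z : Fin n → E, ∑ i, inner (x i) (z i) = 1 :=
    ⟨fun i => act (↑u⁻¹ : B) (y i), by simp [inner_act, ← Finset.sum_mul, ← hxy]⟩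
  have inner_add' : ∀ x y z, inner (x + y) z = inner x z + inner y z := fun x y z => by
    rw [← star_inner, inner_add, star_add, star_inner, star_inner]
  have inner_neg : ∀ x y, inner x (-y) = -inner x y := fun x y =>
    map_neg (AddMonoidHom.mk' (inner x) (inner_add x)) y
  have inner_neg' : ∀ x y, inner (-x) y = -inner x y := fun x y => by
    rw [← star_inner, inner_neg, star_neg, star_inner]
  have hnonneg : ∀ x, 0 ≤ inner x x := fun x => by
    obtain ⟨c, hc⟩ := pos x
    exact hc ▸ star_mul_self_nonneg c
  -- Positivity of `⟪x - z, x - z⟫` bounds the mixed terms by the diagonal ones. Their sum is `2`,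
  -- so `h ≥ 2` is invertible.
  have hle : ∀ i, inner (x i) (z i) + inner (z i) (x i) ≤
      inner (x i) (x i) + inner (z i) (z i) := fun i => by
    rw [← sub_nonneg]
    have := hnonneg (x i + -z i)
    simp only [inner_add, inner_add', inner_neg, inner_neg'] at this
    convert this using 1
    abel
  set h : B := ∑ i, (inner (x i) (x i) + inner (z i) (z i)) with hh
  have h2 : 1 + 1 ≤ h := by
    have hstar : ∑ i, inner (z i) (x i) = 1 := by
      rw [← star_one B, ← hz, star_sum]
      simp [star_inner]
    calc (1 : B) + 1 = ∑ i, (inner (x i) (z i) + inner (z i) (x i)) := by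
          rw [Finset.sum_add_distrib, hz, hstar]
      _ ≤ h := Finset.sum_le_sum fun i _ => hle i
  have h0 : 0 ≤ h := Finset.sum_nonneg fun i _ => add_nonneg (hnonneg _) (hnonneg _)
  have hu : IsUnit h := CStarAlgebra.isUnit_of_le 1 (le_trans (by simp) h2)
  obtain ⟨s, hs⟩ := (CFC.isUnit_sqrt_iff h h0).2 hu
  have hsa : star (s : B) = s := by
    rw [hs]
    exact (CFC.sqrt_nonneg h).isSelfAdjoint
  have hss : (s : B) * s = h := by
    rw [hs]
    exact CFC.sqrt_mul_sqrt_self h h0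
  have hsi : star (↑s⁻¹ : B) = ↑s⁻¹ := by
    have hst : star s = s := Units.ext hsa
    rw [← Units.coe_star, star_inv, hst]
  have hact : ∀ b x y, inner (act b x) y = star b * inner x y := fun b x y => by
    rw [← star_inner, inner_act, star_mul, star_inner]
  -- The frame consists of all `x i` and `z i` rescaled by `h^(-1/2)`, since `h^(-1/2) h h^(-1/2) =
  -- 1`.
  refine ⟨n + n, fun i => act (↑s⁻¹ : B) (Fin.append x z i), ?_⟩
  simp only [inner_act, hact, hsi]
  rw [← Finset.sum_mul, ← Finset.mul_sum, Fin.sum_univ_add]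
  simp only [Fin.append_left, Fin.append_right]
  rw [← Finset.sum_add_distrib, ← hh, ← hss]
  simp

end Frame

/-! ### Corners and trace isomorphisms from frames -/

/-- The algebraic structure of an `A`-`B` imprimitivity bimodule, with the actions given as
functions, so that it can be passed to the conjugate bimodule on the same additive group. -/
structure MoritaContext (A B E : Type*) [CStarAlgebra A] [CStarAlgebra B] [AddCommGroup E] where
  /-- the left action -/
  l : A → E → E
  /-- the right action -/
  r : B → E → E
  /-- the left inner product -/
  li : E → E → A
  /-- the right inner product -/
  ri : E → E → B
  add_l : ∀ a a' x, l (a + a') x = l a x + l a' x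
  l_add : ∀ a x y, l a (x + y) = l a x + l a y
  mul_l : ∀ a a' x, l (a * a') x = l a (l a' x)
  one_l : ∀ x, l 1 x = x
  add_r : ∀ b b' x, r (b + b') x = r b x + r b' x
  r_add : ∀ b x y, r b (x + y) = r b x + r b y
  mul_r : ∀ b b' x, r (b * b') x = r b' (r b x)
  one_r : ∀ x, r 1 x = x
  l_r : ∀ a b x, l a (r b x) = r b (l a x)
  l_complex : ∀ (c : ℂ) x, l (c • 1) x = r (c • 1) x
  add_li : ∀ x y z, li (x + y) z = li x z + li y z
  li_l : ∀ a x y, li (l a x) y = a * li x y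
  star_li : ∀ x y, star (li x y) = li y x
  li_r : ∀ b x y, li (r b x) y = li x (r (star b) y)
  ri_add : ∀ x y z, ri x (y + z) = ri x y + ri x z
  ri_r : ∀ b x y, ri x (r b y) = ri x y * b
  star_ri : ∀ x y, star (ri x y) = ri y x
  ri_l : ∀ a x y, ri (l a x) y = ri x (l (star a) y)
  link : ∀ x y z, l (li x y) z = r (ri y z) x

/-- The bimodule underlying an imprimitivity bimodule. -/
def ImprimitivityBimodule.toMoritaContext {A B E : Type*} [CStarAlgebra A] [CStarAlgebra B]
    [NormedAddCommGroup E] [NormedSpace ℂ E] [CompleteSpace E] [Module A E] [Module Bᵐᵒᵖ E]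
    (M : ImprimitivityBimodule A B E) : MoritaContext A B E where
  l a x := a • x
  r b x := MulOpposite.op b • x
  li := M.leftInner
  ri := M.rightInner
  add_l := add_smul
  l_add := smul_add
  mul_l := mul_smul
  one_l := one_smul A
  add_r b b' x := by rw [MulOpposite.op_add, add_smul]
  r_add b x y := smul_add _ x y
  mul_r b b' x := by rw [MulOpposite.op_mul, mul_smul]
  one_r x := by rw [MulOpposite.op_one, one_smul]
  l_r := M.smul_comm
  l_complex c x := by
    rw [M.complex_smul_left, M.complex_smul_right, MulOpposite.op_one, one_smul, one_smul]
  add_li := M.leftInner_add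
  li_l := M.leftInner_smul
  star_li := M.star_leftInner
  li_r := M.leftInner_adjoint
  ri_add := M.rightInner_add
  ri_r := M.rightInner_smul
  star_ri := M.star_rightInner
  ri_l := M.rightInner_adjoint
  link := M.leftInner_smul_eq

namespace MoritaContext

variable {A B E : Type*} [CStarAlgebra A] [CStarAlgebra B] [AddCommGroup E]
  (M : MoritaContext A B E)

/-- The conjugate bimodule. -/
def conj : MoritaContext B A E where
  l b x := M.r (star b) x
  r a x := M.l (star a) x
  li := M.ri
  ri := M.li
  add_l b b' x := by rw [star_add, M.add_r]
  l_add b x y := M.r_add _ x y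
  mul_l b b' x := by rw [star_mul, M.mul_r]
  one_l x := by rw [star_one, M.one_r]
  add_r a a' x := by rw [star_add, M.add_l]
  r_add a x y := M.l_add _ x y
  mul_r a a' x := by rw [star_mul, M.mul_l]
  one_r x := by rw [star_one, M.one_l]
  l_r b a x := (M.l_r _ _ x).symm
  l_complex c x := by rw [star_smul, star_smul, star_one, star_one, M.l_complex]
  add_li x y z := by rw [← M.star_ri, M.ri_add, star_add, M.star_ri, M.star_ri]
  li_l b x y := by rw [← M.star_ri, M.ri_r, star_mul, star_star, M.star_ri]
  star_li := M.star_ri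
  li_r a x y := M.ri_l _ x y
  ri_add x y z := by rw [← M.star_li, M.add_li, star_add, M.star_li, M.star_li]
  ri_r a x y := by rw [← M.star_li, M.li_l, star_mul, star_star, M.star_li]
  star_ri := M.star_li
  ri_l b x y := M.li_r _ x y
  link x y z := by rw [M.star_ri, M.star_li, M.link]

theorem sum_l {σ : Type*} (s : Finset σ) (f : σ → A) (x : E) :
    M.l (∑ i ∈ s, f i) x = ∑ i ∈ s, M.l (f i) x :=
  map_sum (AddMonoidHom.mk' (fun a => M.l a x) fun a a' => M.add_l a a' x) f s

theorem ri_sum {σ : Type*} (s : Finset σ) (x : E) (f : σ → E) :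
    M.ri x (∑ i ∈ s, f i) = ∑ i ∈ s, M.ri x (f i) :=
  map_sum (AddMonoidHom.mk' (M.ri x) (M.ri_add x)) f s

theorem ri_zero (x : E) : M.ri x 0 = 0 :=
  map_zero (AddMonoidHom.mk' (M.ri x) (M.ri_add x))

theorem zero_li (x : E) : M.li 0 x = 0 :=
  map_zero (AddMonoidHom.mk' (fun y => M.li y x) fun y z => M.add_li y z x)

theorem zero_l (x : E) : M.l 0 x = 0 :=
  map_zero (AddMonoidHom.mk' (fun a => M.l a x) fun a a' => M.add_l a a' x)

theorem zero_r (x : E) : M.r 0 x = 0 :=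
  map_zero (AddMonoidHom.mk' (fun a => M.r a x) fun a a' => M.add_r a a' x)

variable {ι : Type*} [Fintype ι] {ξ : ι → E}

/-- The reconstruction formula: `x = 1 x = ∑ ⟪ξ i, ξ i⟫_A x`, and the linking identity moves each
term to the right action. -/
theorem sum_r_ri (hξ : ∑ i, M.li (ξ i) (ξ i) = 1) (x : E) : ∑ i, M.r (M.ri (ξ i) x) (ξ i) = x := by
  simp_rw [← M.link]
  rw [← M.sum_l, hξ, M.one_l]

variable (hξ : ∑ i, M.li (ξ i) (ξ i) = 1)

/-- The homomorphism `A → M_ι(B)`, `a ↦ (⟪ξ i, a ξ j⟫)`, of a frame `ξ`. -/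
noncomputable def frameHom : A →⋆ₙₐ[ℂ] CStarMatrix ι ι B where
  toFun a := CStarMatrix.ofEntries fun i j => M.ri (ξ i) (M.l a (ξ j))
  map_smul' c a := by
    ext i j
    simp only [CStarMatrix.ofEntries_apply, CStarMatrix.smul_apply, MonoidHom.id_apply]
    rw [← one_mul a, ← smul_mul_assoc, M.mul_l, M.l_complex, M.ri_r, one_mul, mul_smul_comm,
      mul_one]
  map_zero' := by
    ext i j
    simp [M.zero_l, M.ri_zero]
  map_add' a b := by
    ext i j
    simp [M.add_l, M.ri_add]
  map_mul' a b := by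
    ext i j
    simp only [CStarMatrix.mul_apply, CStarMatrix.ofEntries_apply]
    -- Expand `b ξ j` in the frame and move `a` to the other side of the inner product.
    conv_lhs => rw [M.mul_l, ← M.sum_r_ri hξ (M.l b (ξ j)),
      ← star_star a, ← M.ri_l, M.ri_sum]
    simp [M.ri_r, M.ri_l]
  map_star' a := by
    ext i j
    simp [CStarMatrix.star_apply, M.star_ri, M.ri_l]

theorem frameHom_apply (a : A) (i j : ι) :
    M.frameHom hξ a i j = M.ri (ξ i) (M.l a (ξ j)) := rfl

theorem isFullCorner_frameHom {κ : Type*} [Fintype κ] {η : κ → E}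
    (hη : ∑ j, M.ri (η j) (η j) = 1) : IsFullCorner (M.frameHom hξ) where
  injective := by
    rw [injective_iff_map_eq_zero]
    intro a ha
    have h : ∀ j, M.l a (ξ j) = 0 := fun j => by
      rw [← M.sum_r_ri hξ (M.l a (ξ j))]
      refine Finset.sum_eq_zero fun i _ => ?_
      rw [← M.frameHom_apply hξ, ha, CStarMatrix.zero_apply, M.zero_r]
    rw [← mul_one a, ← hξ, Finset.mul_sum]
    exact Finset.sum_eq_zero fun j _ => by rw [← M.li_l, h, M.zero_li]
  exists_eq y := by
    -- The preimage is the sum of the rank-one operators `z ↦ ξ i (y i j) ⟪ξ j, z⟫_B`.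
    refine ⟨∑ j, ∑ i, M.li (M.r (y i j) (ξ i)) (ξ j), CStarMatrix.ext fun u v => ?_⟩
    simp only [CStarMatrix.mul_apply, frameHom_apply, M.sum_l, M.ri_sum, M.one_l, M.link, M.ri_r,
      Finset.sum_mul]
  one_mem J hJ := by
    -- Expanding both arguments in the frame expresses `⟪x, y⟫_B` through the entries `⟪ξ u, ξ v⟫_B`
    -- of the corner projection.
    have h : ∀ x y, M.ri x y ∈ J := fun x y => by
      rw [← M.sum_r_ri hξ y, M.ri_sum]
      refine sum_mem fun v _ => ?_
      rw [M.ri_r, ← M.star_ri, ← M.sum_r_ri hξ x, M.ri_sum, star_sum]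
      refine J.mul_mem_right _ _ (sum_mem fun u _ => ?_)
      rw [M.ri_r, star_mul, M.star_ri]
      refine J.mul_mem_left _ _ ?_
      simpa [frameHom_apply, M.one_l, M.star_ri] using hJ u v
    rw [← hη]
    exact sum_mem fun j _ => h _ _

/-- The trace property turns `∑ φ(⟪ξ i, x⟫ ⟪y, ξ i⟫)` into `∑ φ(⟪y, ξ i⟫ ⟪ξ i, x⟫)`, which
reconstruction collapses; the frame disappears. -/
theorem tracePullback_frameHom_li (φ : boundedTraces B) (x y : E) :
    (tracePullback (M.frameHom hξ) φ : A →L[ℂ] ℂ) (M.li x y) = (φ : B →L[ℂ] ℂ) (M.ri y x) := by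
  rw [tracePullback_apply]
  simp only [frameHom_apply, M.link, M.ri_r]
  simp_rw [φ.2 _ _]
  rw [← map_sum]
  simp_rw [← M.ri_r]
  rw [← M.ri_sum, M.sum_r_ri hξ]

/-- By the frame-free formula the `j`-th diagonal term is `φ(b ⟪η j, η j⟫_B)`, and these inner
products sum to `1`. -/
theorem tracePullback_conj_frameHom {κ : Type*} [Fintype κ] {η : κ → E}
    (hη : ∑ j, M.conj.li (η j) (η j) = 1) (φ : boundedTraces B) :
    tracePullback (M.conj.frameHom hη) (tracePullback (M.frameHom hξ) φ) = φ := by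
  ext b
  rw [tracePullback_apply]
  simp only [frameHom_apply]
  have h : ∀ j, (tracePullback (M.frameHom hξ) φ : A →L[ℂ] ℂ)
      (M.conj.ri (η j) (M.conj.l b (η j))) = (φ : B →L[ℂ] ℂ) (b * M.ri (η j) (η j)) := fun j => by
    have h1 : M.conj.ri (η j) (M.conj.l b (η j)) = M.li (η j) (M.r (star b) (η j)) := rfl
    rw [h1, M.tracePullback_frameHom_li hξ, ← M.star_ri, M.ri_r, star_mul, star_star, M.star_ri]
  simp_rw [h]
  have h1 : ∑ j, M.ri (η j) (η j) = 1 := hη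
  rw [← map_sum, ← Finset.mul_sum, h1, mul_one]

theorem tracePullback_frameHom_conj {κ : Type*} [Fintype κ] {η : κ → E}
    (hη : ∑ j, M.conj.li (η j) (η j) = 1) (ψ : boundedTraces A) :
    tracePullback (M.frameHom hξ) (tracePullback (M.conj.frameHom hη) ψ) = ψ := by
  ext a
  rw [tracePullback_apply]
  have h : ∀ i, (tracePullback (M.conj.frameHom hη) ψ : B →L[ℂ] ℂ)
      (M.frameHom hξ a i i) = (ψ : A →L[ℂ] ℂ) (a * M.li (ξ i) (ξ i)) := fun i => by
    have h1 := M.conj.tracePullback_frameHom_li hη ψ (ξ i) (M.l a (ξ i))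
    rw [← M.li_l]
    exact h1
  simp_rw [h]
  rw [← map_sum, ← Finset.mul_sum, hξ, mul_one]

end MoritaContext

/-! ### Extreme rays of cones with a base -/

section Cone

variable {V W : Type*} [AddCommMonoid V] [Module ℝ V] [AddCommMonoid W] [Module ℝ W]

/-- The extreme points of the base `{x ∈ K | τ x = 1}` of a cone `K` are the points of the base
which lie on extreme rays of `K`. -/
theorem mem_extremePoints_base_iff {K : Set V} (hK : ∀ (c : ℝ) x, 0 ≤ c → x ∈ K → c • x ∈ K)
    {τ : V →ₗ[ℝ] ℝ} (hτ : ∀ x ∈ K, 0 ≤ τ x) (hτ0 : ∀ x ∈ K, τ x = 0 → x = 0) {x : V} :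
    x ∈ {x ∈ K | τ x = 1}.extremePoints ℝ ↔
      (x ∈ K ∧ τ x = 1) ∧ ∀ y ∈ K, ∀ z ∈ K, y + z = x → y = τ y • x := by
  rw [mem_extremePoints_iff_left]
  refine and_congr_right fun hx => ⟨fun h y hy z hz hyz => ?_, fun h x₁ hx₁ x₂ hx₂ hs => ?_⟩
  · have hsum : τ y + τ z = 1 := by rw [← map_add, hyz, hx.2]
    rcases (hτ y hy).eq_or_lt with h0 | hy0
    · rw [← h0, zero_smul]
      exact hτ0 y hy h0.symm
    rcases (hτ z hz).eq_or_lt with h0 | hz0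
    · have hz' := hτ0 z hz h0.symm
      rw [hz', add_zero] at hyz
      rw [hyz, hx.2, one_smul]
    -- With both masses positive, `x` is a convex combination of the normalized `y` and `z`, with
    -- weights `τ y` and `τ z`.
    have := h ((τ y)⁻¹ • y) ⟨hK _ _ (inv_nonneg.2 hy0.le) hy, by
        rw [map_smul, smul_eq_mul, inv_mul_cancel₀ hy0.ne']⟩
      ((τ z)⁻¹ • z) ⟨hK _ _ (inv_nonneg.2 hz0.le) hz, by
        rw [map_smul, smul_eq_mul, inv_mul_cancel₀ hz0.ne']⟩
      ⟨τ y, τ z, hy0, hz0, hsum, by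
        rw [smul_inv_smul₀ hy0.ne', smul_inv_smul₀ hz0.ne', hyz]⟩
    rw [← this, smul_inv_smul₀ hy0.ne']
  · obtain ⟨a, b, ha, hb, -, rfl⟩ := hs
    have := h (a • x₁) (hK a x₁ ha.le hx₁.1) (b • x₂) (hK b x₂ hb.le hx₂.1) rfl
    rw [map_smul, hx₁.2, smul_eq_mul, mul_one] at this
    replace this := congrArg (a⁻¹ • ·) this
    simp only [inv_smul_smul₀ ha.ne'] at this
    exact this

/-- An isomorphism of cones maps extreme points of bases to positive multiples of such points. -/
theorem smul_mem_extremePoints_base {K : Set V} {L : Set W}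
    (hK : ∀ (c : ℝ) x, 0 ≤ c → x ∈ K → c • x ∈ K) (hL : ∀ (c : ℝ) x, 0 ≤ c → x ∈ L → c • x ∈ L)
    {τ : V →ₗ[ℝ] ℝ} (hτ : ∀ x ∈ K, 0 ≤ τ x) (hτ0 : ∀ x ∈ K, τ x = 0 → x = 0)
    {ρ : W →ₗ[ℝ] ℝ} (hρ : ∀ x ∈ L, 0 ≤ ρ x) (hρ0 : ∀ x ∈ L, ρ x = 0 → x = 0)
    (S : V ≃ₗ[ℝ] W) (hS : ∀ x ∈ K, S x ∈ L) (hS' : ∀ x ∈ L, S.symm x ∈ K)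
    {x : V} (hx : x ∈ {x ∈ K | τ x = 1}.extremePoints ℝ) :
    0 < ρ (S x) ∧ (ρ (S x))⁻¹ • S x ∈ {x ∈ L | ρ x = 1}.extremePoints ℝ := by
  rw [mem_extremePoints_base_iff hK hτ hτ0] at hx
  rw [mem_extremePoints_base_iff hL hρ hρ0]
  obtain ⟨⟨hxK, hx1⟩, hx⟩ := hx
  have hpos : 0 < ρ (S x) := by
    refine (hρ _ (hS x hxK)).lt_of_ne fun h0 => ?_
    have := S.map_eq_zero_iff.1 (hρ0 _ (hS x hxK) h0.symm)
    rw [this, map_zero] at hx1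
    exact zero_ne_one hx1
  set t := ρ (S x) with ht
  refine ⟨hpos, ⟨hL _ _ (inv_nonneg.2 hpos.le) (hS x hxK), by
    rw [map_smul, smul_eq_mul, ← ht, inv_mul_cancel₀ hpos.ne']⟩, fun y hy z hz hyz => ?_⟩
  -- Scaling by `t` and applying `S⁻¹` turns the decomposition of `t⁻¹ S x` into one of `x`.
  have h := hx (S.symm (t • y)) (hS' _ (hL t y hpos.le hy)) (S.symm (t • z))
    (hS' _ (hL t z hpos.le hz)) (by
      rw [← map_add, ← smul_add, hyz, smul_inv_smul₀ hpos.ne', S.symm_apply_apply])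
  set c := τ (S.symm (t • y))
  have h2 : t • y = c • S x := by rw [← map_smul, ← h, S.apply_symm_apply]
  have h3 : y = c • t⁻¹ • S x := by
    rw [smul_comm, ← h2, inv_smul_smul₀ hpos.ne']
  have h4 : ρ y = c := by
    rw [h3, map_smul, map_smul, ← ht, smul_eq_mul, smul_eq_mul, inv_mul_cancel₀ hpos.ne', mul_one]
  rw [h4, ← h3]

end Cone

/-! ### The cone of positive traces and its extremal points -/

section Traces

variable {A B : Type*} [CStarAlgebra A] [CStarAlgebra B]

/-- The norm of a positive functional on a unital C⋆-algebra is its value at `1`. -/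
theorem norm_eq_apply_one_of_nonneg {φ : A →L[ℂ] ℂ} (hφ : ∀ a, 0 ≤ φ (star a * a)) :
    ‖φ‖ = (φ 1).re := by
  let _ : PartialOrder A := CStarAlgebra.spectralOrder A
  have _ : StarOrderedRing A := CStarAlgebra.spectralOrderedRing A
  let f : A →ₚ[ℂ] ℂ := PositiveLinearMap.mk₀ φ.toLinearMap fun x hx => by
    obtain ⟨c, rfl⟩ := CStarAlgebra.nonneg_iff_eq_star_mul_self.1 hx
    exact hφ c
  have hf : ∀ a, f a = φ a := fun _ => rfl
  have h1 : 0 ≤ φ 1 := by simpa using hφ 1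
  have h1n : ‖φ 1‖ = (φ 1).re := by
    rw [← Complex.norm_of_nonneg h1.1, ← Complex.eq_re_of_ofReal_le h1]
  refine le_antisymm (φ.opNorm_le_bound h1.1 fun a => ?_) ?_
  -- Cauchy–Schwarz for the form `φ(x⋆ y)`, applied to `1` and `a`.
  · have hcs := norm_inner_le_norm (𝕜 := ℂ) (f.toPreGNS 1) (f.toPreGNS a)
    rw [PositiveLinearMap.preGNS_inner_def, PositiveLinearMap.ofPreGNS_toPreGNS,
      PositiveLinearMap.ofPreGNS_toPreGNS, star_one, one_mul, hf] at hcs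
    refine hcs.trans ?_
    have hn1 : ‖f.toPreGNS 1‖ = √(φ 1).re := by
      simp [PositiveLinearMap.preGNS_norm_def, hf]
    have hna : ‖f.toPreGNS a‖ ≤ √(φ 1).re * ‖a‖ := by
      rw [PositiveLinearMap.preGNS_norm_def, PositiveLinearMap.ofPreGNS_toPreGNS]
      rw [← Real.sqrt_sq (norm_nonneg a), ← Real.sqrt_mul h1.1]
      refine Real.sqrt_le_sqrt ((Complex.re_le_norm _).trans ?_)
      refine (f.norm_apply_le_of_nonneg _ (star_mul_self_nonneg a)).trans ?_
      rw [hf, h1n, CStarRing.norm_star_mul_self, sq]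
    rw [hn1]
    refine (mul_le_mul_of_nonneg_left hna (Real.sqrt_nonneg _)).trans ?_
    rw [← mul_assoc, Real.mul_self_sqrt h1.1]
  · rcases subsingleton_or_nontrivial A with _ | _
    · rw [Subsingleton.elim (1 : A) 0, map_zero]
      exact norm_nonneg φ
    · rw [← h1n]
      simpa using φ.le_opNorm 1

/-- The cone of positive bounded traces. -/
def positiveTraces (A : Type*) [CStarAlgebra A] : Set (boundedTraces A) :=
  {φ | ∀ a : A, 0 ≤ (φ : A →L[ℂ] ℂ) (star a * a)}

/-- The real part of the value of a bounded trace at `1`. -/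
noncomputable def traceMass (A : Type*) [CStarAlgebra A] : boundedTraces A →ₗ[ℝ] ℝ where
  toFun φ := ((φ : A →L[ℂ] ℂ) 1).re
  map_add' φ ψ := by simp
  map_smul' c φ := by
    simp

theorem traceMass_eq_norm {φ : boundedTraces A} (hφ : φ ∈ positiveTraces A) :
    traceMass A φ = ‖(φ : A →L[ℂ] ℂ)‖ :=
  (norm_eq_apply_one_of_nonneg hφ).symm

theorem traceMass_nonneg (φ : boundedTraces A) (hφ : φ ∈ positiveTraces A) :
    0 ≤ traceMass A φ := by
  rw [traceMass_eq_norm hφ]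
  exact norm_nonneg _

theorem eq_zero_of_traceMass_eq_zero (φ : boundedTraces A) (hφ : φ ∈ positiveTraces A)
    (h : traceMass A φ = 0) : φ = 0 := by
  rw [traceMass_eq_norm hφ, norm_eq_zero] at h
  exact Subtype.ext h

theorem smul_mem_positiveTraces (c : ℝ) (φ : boundedTraces A) (hc : 0 ≤ c)
    (hφ : φ ∈ positiveTraces A) : c • φ ∈ positiveTraces A := fun a => by
  have h : ((c • φ : boundedTraces A) : A →L[ℂ] ℂ) (star a * a) =
      (c : ℂ) * (φ : A →L[ℂ] ℂ) (star a * a) := by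
    simp
  rw [h]
  exact mul_nonneg (by exact_mod_cast hc) (hφ a)

/-- On positive traces the norm agrees with the linear functional `traceMass`, so the tracial states
are a base of the cone. -/
theorem tracialStates_eq : tracialStates A = {φ ∈ positiveTraces A | traceMass A φ = 1} := by
  ext φ
  refine and_congr_right fun hφ => ?_
  rw [← traceMass_eq_norm hφ]

theorem real_smul_boundedTraces (c : ℝ) (φ : boundedTraces A) : c • φ = (c : ℂ) • φ := by
  ext a
  simp

/-- A complex linear isomorphism of spaces of bounded traces as a real linear one. -/
noncomputable def realTraceEquiv (S : boundedTraces B ≃ₗ[ℂ] boundedTraces A) :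
    boundedTraces B ≃ₗ[ℝ] boundedTraces A :=
  { S.toAddEquiv with
    map_smul' := fun c φ => by
      have h : S (c • φ) = c • S φ := by
        rw [real_smul_boundedTraces, real_smul_boundedTraces, map_smul]
      exact h }

/-- A linear isomorphism of the spaces of bounded traces which preserves positivity in both
directions maps extremal traces to positive multiples of extremal traces. -/
theorem smul_mem_extremalTraces (S : boundedTraces B ≃ₗ[ℂ] boundedTraces A)
    (hS : ∀ φ ∈ positiveTraces B, S φ ∈ positiveTraces A)
    (hS' : ∀ φ ∈ positiveTraces A, S.symm φ ∈ positiveTraces B)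
    {φ : boundedTraces B} (hφ : φ ∈ extremalTraces B) :
    0 < traceMass A (S φ) ∧ (traceMass A (S φ))⁻¹ • S φ ∈ extremalTraces A := by
  have hφ' : φ ∈ {φ ∈ positiveTraces B | traceMass B φ = 1}.extremePoints ℝ := by
    rw [← tracialStates_eq]
    exact hφ
  have h := smul_mem_extremePoints_base (K := positiveTraces B) (L := positiveTraces A)
    (τ := traceMass B) (ρ := traceMass A) smul_mem_positiveTraces smul_mem_positiveTraces
    traceMass_nonneg eq_zero_of_traceMass_eq_zero traceMass_nonneg eq_zero_of_traceMass_eq_zero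
    (realTraceEquiv S) hS hS' hφ'
  rw [← tracialStates_eq] at h
  exact h

theorem traceMass_eq_one {φ : boundedTraces A} (hφ : φ ∈ extremalTraces A) :
    traceMass A φ = 1 := by
  have := extremePoints_subset hφ
  rw [tracialStates_eq] at this
  exact this.2

/-- The scalar introduced by the first normalization is cancelled by the second. -/
theorem normalize_symm_normalize (S : boundedTraces B ≃ₗ[ℂ] boundedTraces A)
    {φ : boundedTraces B} (hφ : traceMass B φ = 1) (h : 0 < traceMass A (S φ)) :
    (traceMass B (S.symm ((traceMass A (S φ))⁻¹ • S φ)))⁻¹ •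
      S.symm ((traceMass A (S φ))⁻¹ • S φ) = φ := by
  have h1 : S.symm ((traceMass A (S φ))⁻¹ • S φ) = (traceMass A (S φ))⁻¹ • φ := by
    rw [real_smul_boundedTraces, map_smul, S.symm_apply_apply, ← real_smul_boundedTraces]
  rw [h1, map_smul, hφ, smul_eq_mul, mul_one, inv_inv, smul_inv_smul₀ h.ne']

/-- The bijection of the extremal traces induced by an order isomorphism of the spaces of bounded
traces. -/
noncomputable def extremalTracesEquiv (S : boundedTraces B ≃ₗ[ℂ] boundedTraces A)
    (hS : ∀ φ ∈ positiveTraces B, S φ ∈ positiveTraces A)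
    (hS' : ∀ φ ∈ positiveTraces A, S.symm φ ∈ positiveTraces B) :
    extremalTraces B ≃ extremalTraces A where
  toFun φ := ⟨_, (smul_mem_extremalTraces S hS hS' φ.2).2⟩
  invFun φ := ⟨_, (smul_mem_extremalTraces S.symm hS' hS φ.2).2⟩
  left_inv φ := Subtype.ext <| normalize_symm_normalize S (traceMass_eq_one φ.2)
    (smul_mem_extremalTraces S hS hS' φ.2).1
  right_inv φ := Subtype.ext <| normalize_symm_normalize S.symm (traceMass_eq_one φ.2)
    (smul_mem_extremalTraces S.symm hS' hS φ.2).1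

theorem apply_eq_smul_extremalTracesEquiv (S : boundedTraces B ≃ₗ[ℂ] boundedTraces A)
    (hS : ∀ φ ∈ positiveTraces B, S φ ∈ positiveTraces A)
    (hS' : ∀ φ ∈ positiveTraces A, S.symm φ ∈ positiveTraces B) (φ : extremalTraces B) :
    S φ = ((traceMass A (S φ) : ℝ) : ℂ) •
      (extremalTracesEquiv S hS hS' φ : boundedTraces A) := by
  have h := (smul_mem_extremalTraces S hS hS' φ.2).1
  have h1 : (extremalTracesEquiv S hS hS' φ : boundedTraces A) =
    (traceMass A (S φ))⁻¹ • S φ := rfl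
  rw [h1, ← real_smul_boundedTraces, smul_inv_smul₀ h.ne']

end Traces

/-! ### Matrices of composed maps -/

section Conjugation

theorem map_sum_smul_eq_mul {V W : Type*} [AddCommMonoid V] [Module ℂ V] [AddCommMonoid W]
    [Module ℂ W] {n : ℕ} {v : Fin n → V} {w : Fin n → W} (F : V →ₗ[ℂ] W)
    {N : Matrix (Fin n) (Fin n) ℂ} (hF : ∀ j, F (v j) = ∑ i, N i j • w i)
    (K : Matrix (Fin n) (Fin n) ℂ) (j : Fin n) :
    F (∑ i, K i j • v i) = ∑ i, (N * K) i j • w i := by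
  simp only [map_sum, map_smul, hF, Finset.smul_sum, Matrix.mul_apply, Finset.sum_smul, smul_smul]
  rw [Finset.sum_comm]
  simp only [mul_comm]

/-- If `S`, `T` and `R` have the matrices `P`, `M` and `Q`, then `R ∘ T ∘ S` has the matrix
`Q * M * P`. -/
theorem apply_conj_eq_sum {V W : Type*} [AddCommMonoid V] [Module ℂ V] [AddCommMonoid W]
    [Module ℂ W] {n : ℕ} {v : Fin n → V} {w : Fin n → W} {P Q M : Matrix (Fin n) (Fin n) ℂ}
    (S : W →ₗ[ℂ] V) (R : V →ₗ[ℂ] W) (T : V →ₗ[ℂ] V)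
    (hS : ∀ j, S (w j) = ∑ i, P i j • v i) (hR : ∀ j, R (v j) = ∑ i, Q i j • w i)
    (hT : ∀ j, T (v j) = ∑ i, M i j • v i) (j : Fin n) :
    R (T (S (w j))) = ∑ i, (Q * M * P) i j • w i := by
  rw [hS, map_sum_smul_eq_mul T hT, map_sum_smul_eq_mul R hR, mul_assoc]

end Conjugation

/-! ### The trace isomorphism of a Morita equivalence and the main theorem -/

section Morita

variable {A : Type u} {B : Type v} [CStarAlgebra A] [CStarAlgebra B]

/-- A Morita equivalence induces an order isomorphism of the spaces of bounded traces which
conjugates the maps of self-similar pairs on `A` to those of self-similar pairs on `B`. -/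
theorem MoritaEquivalent.exists_traceEquiv (hAB : MoritaEquivalent.{u, v, w} A B) :
    ∃ S : boundedTraces B ≃ₗ[ℂ] boundedTraces A,
      (∀ φ ∈ positiveTraces B, S φ ∈ positiveTraces A) ∧
      (∀ φ ∈ positiveTraces A, S.symm φ ∈ positiveTraces B) ∧
      (∀ T ∈ traceFundamentalGroup A, ∃ T' ∈ traceFundamentalGroup B,
        ∀ φ, T' φ = S.symm (T (S φ))) ∧
      (∀ T ∈ traceFundamentalGroup B, ∃ T' ∈ traceFundamentalGroup A,
        ∀ φ, T' φ = S (T (S.symm φ))) := by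
  obtain ⟨E, _, _, _, _, _, ⟨N⟩⟩ := hAB
  let M : MoritaContext A B E := N.toMoritaContext
  -- The left frame is a right frame of the conjugate bimodule.
  obtain ⟨m, ξ, hξ⟩ := exists_sum_inner_self_eq_one (fun a x => M.conj.r a x) M.li M.conj.ri_add
    M.conj.ri_r M.star_li N.leftInner_self_pos N.left_full
  obtain ⟨n, η, hη⟩ := exists_sum_inner_self_eq_one (fun b x => M.r b x) M.ri M.ri_add
    M.ri_r M.star_ri N.rightInner_self_pos N.right_full
  have hη' : ∑ j, M.conj.li (η j) (η j) = 1 := hη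
  have hΘ : IsFullCorner (M.frameHom hξ) := M.isFullCorner_frameHom hξ hη
  have hΨ : IsFullCorner (M.conj.frameHom hη') := M.conj.isFullCorner_frameHom hη' hξ
  refine ⟨{ tracePullback (M.frameHom hξ) with
    invFun := tracePullback (M.conj.frameHom hη')
    left_inv := M.tracePullback_conj_frameHom hξ hη'
    right_inv := M.tracePullback_frameHom_conj hξ hη' }, ?_, ?_, ?_, ?_⟩
  · exact fun φ hφ => tracePullback_nonneg _ hφ
  · exact fun φ hφ => tracePullback_nonneg _ hφ
  · exact fun T hT => exists_mem_traceFundamentalGroup_conj hΘ hΨ hT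
  · exact fun T hT => exists_mem_traceFundamentalGroup_conj hΨ hΘ hT

end Morita

theorem mainTheorem2 {A : Type u} {B : Type v} [CStarAlgebra A] [CStarAlgebra B]
    [FiniteDimensional ℂ (boundedTraces A)] [FiniteDimensional ℂ (boundedTraces B)]
    (hAB : MoritaEquivalent.{u, v, w} A B) :
    Module.finrank ℂ (boundedTraces A) = Module.finrank ℂ (boundedTraces B) ∧
      Nonempty (extremalTraces A ≃ extremalTraces B) ∧
      ∀ (n : ℕ) (e : Fin n ≃ extremalTraces A) (f : Fin n ≃ extremalTraces B),
        WeightedlyIsomorphic (fundamentalGroup e) (fundamentalGroup f) ∧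
          detFundamentalGroup e = detFundamentalGroup f := by
  obtain ⟨S, hS, hS', hF, hF'⟩ := hAB.exists_traceEquiv
  refine ⟨S.symm.finrank_eq, ⟨(extremalTracesEquiv S hS hS').symm⟩, fun n e f => ?_⟩
  let π : Equiv.Perm (Fin n) := (f.trans (extremalTracesEquiv S hS hS')).trans e.symm
  let t : Fin n → ℝ := fun j => traceMass A (S (f j))
  have ht : ∀ j, 0 < t j := fun j => (smul_mem_extremalTraces S hS hS' (f j).2).1
  have hSf : ∀ j, S (f j : boundedTraces B) = (t j : ℂ) • (e (π j) : boundedTraces A) :=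
    fun j => by
      rw [apply_eq_smul_extremalTracesEquiv S hS hS' (f j)]
      simp [π, t]
  -- Column `j` of the matrix of `S` has its only entry `t j` in row `π j`. With the convention
  -- `U(σ) i j = 1` iff `j = σ i`, this forces `σ = π⁻¹` and `d i = t (π⁻¹ i)`.
  let d : Fin n → ℝ := fun i => t (π.symm i)
  have hd : ∀ i, 0 < d i := fun i => ht _
  set P : Matrix (Fin n) (Fin n) ℂ :=
    Matrix.diagonal (fun i => (d i : ℂ)) * Equiv.Perm.permMatrix ℂ π.symm with hP
  have hPu : IsUnit P.det := by
    rw [hP, Matrix.det_mul, Matrix.det_diagonal, Matrix.det_permutation]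
    refine IsUnit.mul (isUnit_iff_ne_zero.2 (Finset.prod_ne_zero_iff.2 fun i _ => ?_)) ?_
    · exact_mod_cast (hd i).ne'
    · exact isUnit_iff_ne_zero.2 (by exact_mod_cast (Equiv.Perm.sign π.symm).ne_zero)
  have hPS : ∀ j, S (f j : boundedTraces B) = ∑ i, P i j • (e i : boundedTraces A) := fun j => by
    rw [hSf, Finset.sum_eq_single (π j)]
    · simp [hP, d, Equiv.Perm.permMatrix, PEquiv.toMatrix_apply]
    · intro i _ hi
      have : π.symm i ≠ j := fun h => hi (by rw [← h, Equiv.apply_symm_apply])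
      simp [hP, Equiv.Perm.permMatrix, PEquiv.toMatrix_apply, this]
    · simp
  have hPR : ∀ j, S.symm (e j : boundedTraces A) = ∑ i, P⁻¹ i j • (f i : boundedTraces B) :=
    fun j => by
      apply S.injective
      have h := map_sum_smul_eq_mul (v := fun j => (f j : boundedTraces B))
        (w := fun j => (e j : boundedTraces A)) S.toLinearMap hPS P⁻¹ j
      rw [Matrix.mul_nonsing_inv P hPu] at h
      rw [S.apply_symm_apply]
      refine Eq.trans ?_ h.symm
      simp [Matrix.one_apply]
  have key : fundamentalGroup f = (fun M => P⁻¹ * M * P) '' fundamentalGroup e := by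
    ext M
    constructor
    · rintro ⟨T, hT, hM⟩
      obtain ⟨T', hT', h⟩ := hF' T hT
      -- This is the matrix of `S T S⁻¹`, which comes from a self-similar pair on `A`.
      refine ⟨P * M * P⁻¹, ⟨T', hT', fun j => ?_⟩, ?_⟩
      · rw [h]
        exact apply_conj_eq_sum (v := fun j => (f j : boundedTraces B))
          (w := fun j => (e j : boundedTraces A)) S.symm.toLinearMap S.toLinearMap T.toLinearMap hPR hPS hM j
      · simp only [mul_assoc]
        rw [Matrix.nonsing_inv_mul P hPu, mul_one, ← mul_assoc, Matrix.nonsing_inv_mul P hPu,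
          one_mul]
    · rintro ⟨M, ⟨T, hT, hM⟩, rfl⟩
      obtain ⟨T', hT', h⟩ := hF T hT
      refine ⟨T', hT', fun j => ?_⟩
      rw [h]
      exact apply_conj_eq_sum (v := fun j => (e j : boundedTraces A))
        (w := fun j => (f j : boundedTraces B)) S.toLinearMap S.symm.toLinearMap T.toLinearMap hPS hPR hM j
  refine ⟨⟨d, π.symm, hd, key⟩, ?_⟩
  rw [detFundamentalGroup, detFundamentalGroup, key, Set.image_image]
  refine Set.image_congr fun M _ => ?_
  rw [Matrix.det_conj' ((Matrix.isUnit_iff_isUnit_det P).2 hPu)]
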